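/- \textbf{Corollary (Sharp ensemble bounds).} For an integer $N\ge 1$ let $\Lambda_N=\{k\in\mathbb Z^3\setminus\{0\}:|k|_\infty\le N\}$, let the octahedral group $O_h$ (the $48$ signed permutations of the coordinates) act on $\Lambda_N$, and let $\mathcal O_N=\Lambda_N/O_h$ be the set of orbits $\Omega_\alpha$. For $k\ne 0$ let $P(k)=I-\frac{k\otimes k}{|k|^2}$, where $|k|$ is the Euclidean norm. \emph{Stretching matrix.} For a field $\hat u=(\hat u_k)_{k\in\Lambda_N}$ of vectors in $\mathbb C^3$ put, for $\alpha,\beta\in\mathcal O_N$, \[ S_{\alpha\beta}=\frac1{|\Omega_\alpha|}\sum_{k\in\Omega_\alpha}\ \sum_{\substack{p\in\Omega_\beta\\ q=k-p\in\Lambda_N}}|k|^2\,\mathrm{Re}\bigl(\overline{\hat u_k}\cdot N_{k,p}\bigr),\qquad N_{k,p}=-i\,P(k)\bigl[q\,(\hat u_p\cdot\hat u_q)\bigr], \] where $v\cdot w=\sum_j v_jw_j$, let $V_N=\bigl(\tfrac12(S_{\alpha\beta}+S_{\beta\alpha})\bigr)_{\alpha,\beta}$, let $\rho(V_N)$ be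 the spectral radius of $V_N$, and let $\nu_c^*(N)=\rho(V_N)/N^2$. \emph{Ensemble.} Choose one representative of each pair $\{k,-k\}\subset\Lambda_N$, and for the chosen $k$ let $X_k$ be independent random vectors in $\mathbb C^3$ whose coordinates are independent standard complex Gaussians. Let $a\in\{0,1\}$. Put $v_k=|k|^{-a}P(k)X_k$ and $v_{-k}=\overline{v_k}$ for the chosen $k$, and normalize: \[ \hat u_k=\frac{v_k}{\sqrt W},\qquad W=\frac12\sum_{\ell\in\Lambda_N}|\ell|^2|v_\ell|^2, \] so that almost surely $\hat u_{-k}=\overline{\hat u_k}$, $k\cdot\hat u_k=0$ and $\frac12\sum_{k\in\Lambda_N}|k|^2|\hat u_k|^2=1$. (Here $a=0$ is the unweighted isotropic Gaussian ensemble, and $a=1$ is the one with prior $\mathbb E|v_k|^2\propto|k|^{-2}$.) There is an absolute constant $C>0$ such that for every $N\ge1$ and each $a\in\{0,1\}$ the random variable $\rho(V_N)$ is integrable, \[ \mathbb E\,\rho(V_N)\le C\,N^{-3/2}, \qquad\text{and consequently}\qquad \mathbb E\,\nu_c^*(N)=\frac{\mathbb E\,\rho(V_N)}{N^2}\le C\,N^{-7/2}.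 \] -/

import Mathlib

open MeasureTheory ProbabilityTheory

namespace CubicGalerkin

/-- Wave vectors in `ℤ³`. -/
abbrev Wave : Type := Fin 3 → ℤ

/-- Vectors in `ℂ³`. -/
abbrev CVec : Type := Fin 3 → ℂ

/-- The squared Euclidean length `|k|²` of a wave vector, as a real number. -/
def normSq (k : Wave) : ℝ := ∑ i, (k i : ℝ) ^ 2

/-- The bilinear product `v · w` on `ℂ³` (no conjugation). -/
def dot (v w : CVec) : ℂ := ∑ i, v i * w i

/-- The coordinatewise complex conjugate of a vector of `ℂ³`. -/
def conjVec (v : CVec) : CVec := fun i => starRingEnd ℂ (v i)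

/-- A wave vector regarded as a vector of `ℂ³`. -/
def waveVec (k : Wave) : CVec := fun i => (k i : ℂ)

/-- The Leray projector `P(k) = I - (k ⊗ k) / |k|²` applied to a vector of `ℂ³`. -/
noncomputable def leray (k : Wave) (v : CVec) : CVec :=
  fun i => v i - dot (waveVec k) v / (normSq k : ℂ) * (k i : ℂ)

/-- The truncated lattice `Λ_N = {k ∈ ℤ³ ∖ {0} : |k|_∞ ≤ N}`. -/
noncomputable def lattice (N : ℕ) : Finset Wave :=
  (Fintype.piFinset fun _ => Finset.Icc (-(N : ℤ)) (N : ℤ)).erase 0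

/-- The lexicographically positive wave vectors; of two nonzero vectors `k`, `-k` exactly one
is positive. -/
def IsPositive (k : Wave) : Prop :=
  0 < k 0 ∨ (k 0 = 0 ∧ 0 < k 1) ∨ (k 0 = 0 ∧ k 1 = 0 ∧ 0 < k 2)

open Classical in
/-- The half-lattice: one representative of each pair `{k, -k}` of retained modes. -/
noncomputable def halfLattice (N : ℕ) : Finset Wave := (lattice N).filter IsPositive

/-! ### Orbits of the full octahedral group -/

/-- Two wave vectors lie in the same orbit of the full octahedral group `O_h`, i.e. they differ
by one of the 48 signed permutations of the coordinates. -/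
def SameOrbit (k l : Wave) : Prop :=
  ∃ (σ : Equiv.Perm (Fin 3)) (ε : Fin 3 → ℤˣ), ∀ i, l i = (ε i : ℤ) * k (σ i)

theorem SameOrbit.refl (k : Wave) : SameOrbit k k := ⟨1, fun _ => 1, by simp⟩

theorem SameOrbit.symm {k l : Wave} (h : SameOrbit k l) : SameOrbit l k := by
  obtain ⟨σ, ε, h⟩ := h
  refine ⟨σ⁻¹, fun i => ε (σ⁻¹ i), fun i => ?_⟩
  rw [h (σ⁻¹ i), ← mul_assoc, ← Units.val_mul, Int.units_mul_self]
  simp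

theorem SameOrbit.trans {k l m : Wave} (h : SameOrbit k l) (h' : SameOrbit l m) :
    SameOrbit k m := by
  obtain ⟨σ, ε, h⟩ := h
  obtain ⟨τ, δ, h'⟩ := h'
  refine ⟨σ * τ, fun i => δ i * ε (τ i), fun i => ?_⟩
  rw [h' i, h (τ i), Units.val_mul, mul_assoc, Equiv.Perm.mul_apply]

/-- The orbit equivalence relation on `Λ_N`. -/
def orbitSetoid (N : ℕ) : Setoid (lattice N) where
  r k l := SameOrbit k l
  iseqv := ⟨fun k => SameOrbit.refl k, SameOrbit.symm, SameOrbit.trans⟩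

/-- The orbit set `Λ_N / O_h`. -/
def Orbit (N : ℕ) : Type := Quotient (orbitSetoid N)

noncomputable instance (N : ℕ) : DecidableEq (Orbit N) := Classical.decEq _

noncomputable instance (N : ℕ) : Fintype (Orbit N) :=
  @Fintype.ofFinite _ (inferInstanceAs (Finite (Quotient (orbitSetoid N))))

open Classical in
/-- The orbit `Ω_α ⊆ Λ_N` with index `α`. -/
noncomputable def orbitModes {N : ℕ} (α : Orbit N) : Finset Wave :=
  (Finset.univ.filter fun k : lattice N => (Quotient.mk (orbitSetoid N) k : Orbit N) = α).map
    (Function.Embedding.subtype _)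

/-! ### Transfer and stretching matrices -/

/-- The contribution `N_{k,p} = -i P(k)[q (û_p · û_q)]`, `q = k - p`, of the mode `p` to the
nonlinear term at the mode `k`. -/
noncomputable def nonlinearTerm (u : Wave → CVec) (k p : Wave) : CVec :=
  fun i => -Complex.I * leray k (fun j => ((k - p) j : ℂ) * dot (u p) (u (k - p))) i

/-- The raw orbit-pair transfer matrix
`S_{αβ} = |Ω_α|⁻¹ ∑_{k ∈ Ω_α} ∑_{p ∈ Ω_β, k - p ∈ Λ_N} |k|² Re (conj û_k · N_{k,p})`. -/
noncomputable def transferMatrix (N : ℕ) (u : Wave → CVec) : Matrix (Orbit N) (Orbit N) ℝ :=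
  Matrix.of fun α β =>
    ((orbitModes α).card : ℝ)⁻¹ *
      ∑ k ∈ orbitModes α, ∑ p ∈ orbitModes β with k - p ∈ lattice N,
        normSq k * (dot (conjVec (u k)) (nonlinearTerm u k p)).re

/-- The orbit-level stretching matrix `V_N`, the symmetric part of the transfer matrix. -/
noncomputable def stretchingMatrix (N : ℕ) (u : Wave → CVec) : Matrix (Orbit N) (Orbit N) ℝ :=
  Matrix.of fun α β => (transferMatrix N u α β + transferMatrix N u β α) / 2

/-- The spectral radius `ρ(V_N)`: the largest modulus of a complex eigenvalue. -/
noncomputable def stretchingRadius (N : ℕ) (u : Wave → CVec) : ℝ :=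
  (spectralRadius ℂ ((stretchingMatrix N u).map fun x : ℝ => (x : ℂ))).toReal

/-- The critical-threshold ratio `ν_c^*(N) = ρ(V_N) / N²`. -/
noncomputable def criticalThreshold (N : ℕ) (u : Wave → CVec) : ℝ :=
  stretchingRadius N u / (N : ℝ) ^ 2

/-! ### The isotropic unit-energy Gaussian ensemble -/

/-- The law of a standard complex Gaussian `z`: its real and imaginary parts are independent
centred Gaussians of variance `1/2`, so that `E |z|² = 1`. -/
noncomputable def stdComplexGaussian : Measure ℂ :=
  ((gaussianReal 0 (1 / 2)).prod (gaussianReal 0 (1 / 2))).map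
    Complex.measurableEquivRealProd.symm

instance : IsProbabilityMeasure stdComplexGaussian :=
  Measure.isProbabilityMeasure_map Complex.measurableEquivRealProd.symm.measurable.aemeasurable

/-- The coordinates of the ensemble: one vector of `ℂ³` for each half-lattice mode. -/
abbrev Coordinates (N : ℕ) : Type := halfLattice N → CVec

/-- The law under which all coordinates are independent standard complex Gaussians. -/
noncomputable def coordinateLaw (N : ℕ) : Measure (Coordinates N) :=
  Measure.pi fun _ => Measure.pi fun _ => stdComplexGaussian

open Classical in
/-- The unnormalized field: `v_k = |k|^{-a} P(k) X_k` on the half-lattice, extended by the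
reality condition `v_{-k} = conj v_k`, and zero outside `Λ_N`. -/
noncomputable def rawField (N : ℕ) (a : ℕ) (X : Coordinates N) (k : Wave) : CVec :=
  if h : k ∈ halfLattice N then
    fun i => ((Real.sqrt (normSq k) ^ a : ℝ) : ℂ)⁻¹ * leray k (X ⟨k, h⟩) i
  else if h : -k ∈ halfLattice N then
    conjVec fun i => ((Real.sqrt (normSq (-k)) ^ a : ℝ) : ℂ)⁻¹ * leray (-k) (X ⟨-k, h⟩) i
  else 0

/-- The energy `(1/2) ∑_{k ∈ Λ_N} |k|² |v_k|²`. -/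
noncomputable def energy (N : ℕ) (v : Wave → CVec) : ℝ :=
  (1 / 2) * ∑ k ∈ lattice N, normSq k * ∑ i, ‖v k i‖ ^ 2

/-- The random field of the isotropic ensemble: the raw field normalized to energy `1`. -/
noncomputable def ensembleField (N : ℕ) (a : ℕ) (X : Coordinates N) (k : Wave) : CVec :=
  fun i => rawField N a X k i / (Real.sqrt (energy N (rawField N a X)) : ℂ)

end CubicGalerkin

/-!
The spectral radius of `V_N` is at most its Frobenius norm, and the Frobenius norm alone already
has the asserted size; no cancellation between the entries is needed.

Orbits have at most `48` elements, so by Cauchy-Schwarz the squared Frobenius norm is at most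
`48` times the sum over all pairs `(k, p)` of the squared transfer terms
(`stretchingRadius_sq_le`). As the Leray projector is a contraction, a squared transfer term is at
most `|k|⁴ |q|² |û_k|² |û_p|² |û_q|²` with `q = k - p`. Writing `û_k` through the Gaussian
coordinates gives `ρ(V_N)² ≤ A · W⁻³`, where `W` is the energy of the unnormalized field and `A` is
a weighted sum of the products `|X_k|² |X_p|² |X_q|²`
(`stretchingRadius_ensembleField_sq_le`). Hence `ρ(V_N) ≤ c A + c⁻¹ W⁻³` for every `c > 0`, and with
a suitable power `c` of `N` the claim follows from two moment bounds.

* `E A = O(N^{12 - 6a})`. The Gaussian factor has bounded mean, so only the weights have to be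
  summed (`sum_pairWeight_le`). For `a = 1` this uses `∑_{p ∈ Λ_N} |p|⁻² = O(N)`.
* `E W⁻³ = O(N^{-(15 - 6a)})`. A single mode does not have enough degrees of freedom for
  an inverse third moment, so modes are collected in groups of four. There are at least `(N/2)³`
  disjoint groups of modes with `|k| ≥ N/2`, and convexity of `x ↦ x⁻³` bounds `W⁻³` by an average
  over groups (`ofReal_inv_pow_three_le`). In a group, the inequality of arithmetic and geometric
  mean leaves a product of four independent factors `|z|^{-3/2}`, where
  `z = x₁ - (k₁/k₀) x₀` is controlled by `P(k)x`. Each has bounded mean because, conditionally on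
  `x₀`, the variable `z` is a shifted complex Gaussian, whose density is bounded
  (`exists_lintegral_enorm_sub_rpow_le`).

Measurability of the spectral radius comes from Gelfand's formula.
-/

/-! ### Spectral radius and Frobenius norm -/

section SpectralRadius

open Filter Topology
open scoped Matrix.Norms.Frobenius

variable {n : Type*} [Fintype n] [DecidableEq n]

theorem tendsto_frobenius_pow_spectralRadius (A : Matrix n n ℂ) :
    Tendsto (fun m : ℕ => ((‖A ^ m‖₊ : ENNReal) ^ (1 / m : ℝ))) atTop
      (𝓝 (spectralRadius ℂ A)) :=
  have : CompleteSpace (Matrix n n ℂ) := FiniteDimensional.complete ℂ _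
  spectrum.pow_nnnorm_pow_one_div_tendsto_nhds_spectralRadius A

/-- The Frobenius norm is submultiplicative, so Gelfand's formula bounds the spectral radius by
it, although the identity matrix does not have Frobenius norm `1`. -/
theorem spectralRadius_le_frobenius (A : Matrix n n ℂ) : spectralRadius ℂ A ≤ ‖A‖₊ := by
  refine le_of_tendsto (tendsto_frobenius_pow_spectralRadius A) ?_
  filter_upwards [eventually_gt_atTop 0] with m hm
  have h : (‖A ^ m‖₊ : ENNReal) ≤ (‖A‖₊ : ENNReal) ^ m := by
    exact_mod_cast nnnorm_pow_le' A hm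
  calc ((‖A ^ m‖₊ : ENNReal) ^ (1 / m : ℝ))
      ≤ ((‖A‖₊ : ENNReal) ^ m) ^ (1 / m : ℝ) := by gcongr
    _ = ‖A‖₊ := by
      rw [← ENNReal.rpow_natCast, ← ENNReal.rpow_mul, mul_one_div_cancel, ENNReal.rpow_one]
      exact_mod_cast hm.ne'

theorem sq_toReal_spectralRadius_le (A : Matrix n n ℂ) :
    (spectralRadius ℂ A).toReal ^ 2 ≤ ∑ i, ∑ j, ‖A i j‖ ^ 2 := by
  have h : (spectralRadius ℂ A).toReal ≤ ‖A‖ := by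
    simpa using ENNReal.toReal_mono (by simp) (spectralRadius_le_frobenius A)
  have h0 : 0 ≤ ∑ i, ∑ j, ‖A i j‖ ^ 2 := by positivity
  calc (spectralRadius ℂ A).toReal ^ 2 ≤ ‖A‖ ^ 2 := by gcongr
    _ = ∑ i, ∑ j, ‖A i j‖ ^ 2 := by
      rw [Matrix.frobenius_norm_def, ← Real.sqrt_eq_rpow]
      simp only [Real.rpow_two]
      exact Real.sq_sqrt h0

theorem measurable_spectralRadius {Ω : Type*} [MeasurableSpace Ω] {A : Ω → Matrix n n ℂ}
    (hA : ∀ i j, Measurable fun ω => A ω i j) : Measurable fun ω => spectralRadius ℂ (A ω) := by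
  have hpow : ∀ m : ℕ, ∀ i j, Measurable fun ω => (A ω ^ m) i j := by
    intro m
    induction m with
    | zero => intro i j; simp
    | succ m ih =>
      intro i j
      simp only [pow_succ, Matrix.mul_apply]
      exact Finset.measurable_sum _ fun l _ => (ih i l).mul (hA l j)
  refine measurable_of_tendsto_metrizable (f := fun (m : ℕ) ω =>
    ((‖A ω ^ m‖₊ : ENNReal) ^ (1 / m : ℝ))) (fun m => ?_)
    (tendsto_pi_nhds.2 fun ω => tendsto_frobenius_pow_spectralRadius (A ω))
  refine Measurable.pow_const (measurable_coe_nnreal_ennreal.comp ?_) _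
  simp only [Matrix.frobenius_nnnorm_def]
  refine Measurable.pow_const (Finset.measurable_sum _ fun i _ => Finset.measurable_sum _
    fun j _ => ?_) _
  exact ((hpow m i j).nnnorm).pow_const _

end SpectralRadius

namespace CubicGalerkin

/-! ### The transfer terms -/

/-- The squared Euclidean length `|v|² = ∑ |v_i|²` of a vector of `ℂ³`. -/
noncomputable def vecSq (v : CVec) : ℝ := ∑ i, ‖v i‖ ^ 2

theorem vecSq_nonneg (v : CVec) : 0 ≤ vecSq v := by unfold vecSq; positivity

theorem normSq_nonneg (k : Wave) : 0 ≤ normSq k := by unfold normSq; positivity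

theorem vecSq_conjVec (v : CVec) : vecSq (conjVec v) = vecSq v := by simp [vecSq, conjVec]

theorem vecSq_mul (c : ℂ) (v : CVec) : vecSq (fun i => c * v i) = ‖c‖ ^ 2 * vecSq v := by
  simp [vecSq, mul_pow, Finset.mul_sum]

theorem vecSq_waveVec (k : Wave) : vecSq (waveVec k) = normSq k := by
  simp [vecSq, waveVec, normSq]

theorem norm_dot_sq_le (v w : CVec) : ‖dot v w‖ ^ 2 ≤ vecSq v * vecSq w := by
  calc ‖dot v w‖ ^ 2 ≤ (∑ i, ‖v i‖ * ‖w i‖) ^ 2 := by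
        gcongr
        refine (norm_sum_le _ _).trans_eq ?_
        simp
    _ ≤ vecSq v * vecSq w := Finset.sum_mul_sq_le_sq_mul_sq _ _ _

theorem vecSq_leray_le (k : Wave) (v : CVec) : vecSq (leray k v) ≤ vecSq v := by
  rcases (normSq_nonneg k).eq_or_lt with h0 | h0
  · simp [leray, vecSq, ← h0]
  set c : ℂ := dot (waveVec k) v / (normSq k : ℂ) with hc
  have hd : dot (waveVec k) v = c * (normSq k : ℂ) := by
    rw [hc, div_mul_cancel₀]
    exact_mod_cast h0.ne'
  -- Expanding the square gives `|P(k)v|² = |v|² - |c|²|k|²`, where `c = (k · v) / |k|²`.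
  have hre := congrArg Complex.re hd
  have him := congrArg Complex.im hd
  have hl : ∀ i, leray k v i = v i - c * (k i : ℂ) := fun i => rfl
  simp only [dot, waveVec, Fin.sum_univ_three, Complex.add_re, Complex.mul_re, Complex.add_im,
    Complex.mul_im, Complex.intCast_re, Complex.intCast_im, Complex.ofReal_re,
    Complex.ofReal_im] at hre him
  have hN : normSq k = (k 0 : ℝ) ^ 2 + (k 1 : ℝ) ^ 2 + (k 2 : ℝ) ^ 2 := by
    simp [normSq, Fin.sum_univ_three]
  have key : vecSq (leray k v) = vecSq v - (c.re ^ 2 + c.im ^ 2) * normSq k := by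
    simp only [vecSq, hl, Fin.sum_univ_three, Complex.sq_norm, Complex.normSq_apply,
      Complex.sub_re, Complex.sub_im, Complex.mul_re, Complex.mul_im, Complex.intCast_re,
      Complex.intCast_im]
    linear_combination (-2 * c.re) * hre + (-2 * c.im) * him - (c.re ^ 2 + c.im ^ 2) * hN
  rw [key]
  have := mul_nonneg (add_nonneg (sq_nonneg c.re) (sq_nonneg c.im)) h0.le
  linarith

/-- The contribution `|k|² Re (conj û_k · N_{k,p})` of the pair `(k, p)` to the transfer
matrix. -/
noncomputable def transferTerm (u : Wave → CVec) (k p : Wave) : ℝ :=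
  normSq k * (dot (conjVec (u k)) (nonlinearTerm u k p)).re

theorem transferTerm_sq_le (u : Wave → CVec) (k p : Wave) :
    transferTerm u k p ^ 2 ≤
      normSq k ^ 2 * normSq (k - p) * (vecSq (u k) * vecSq (u p) * vecSq (u (k - p))) := by
  have hN : vecSq (nonlinearTerm u k p) ≤
      normSq (k - p) * (vecSq (u p) * vecSq (u (k - p))) := by
    have h1 : vecSq (nonlinearTerm u k p) =
        vecSq (leray k fun j => ((k - p) j : ℂ) * dot (u p) (u (k - p))) := by
      unfold nonlinearTerm
      rw [vecSq_mul]
      simp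
    rw [h1]
    refine (vecSq_leray_le _ _).trans ?_
    have h2 : (fun j => ((k - p) j : ℂ) * dot (u p) (u (k - p))) =
        fun j => dot (u p) (u (k - p)) * waveVec (k - p) j := by
      funext j; simp [waveVec, mul_comm]
    rw [h2, vecSq_mul, vecSq_waveVec, mul_comm]
    exact mul_le_mul_of_nonneg_left (norm_dot_sq_le _ _) (normSq_nonneg _)
  have hre : (dot (conjVec (u k)) (nonlinearTerm u k p)).re ^ 2 ≤
      vecSq (u k) * (normSq (k - p) * (vecSq (u p) * vecSq (u (k - p)))) := by
    calc (dot (conjVec (u k)) (nonlinearTerm u k p)).re ^ 2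
        ≤ ‖dot (conjVec (u k)) (nonlinearTerm u k p)‖ ^ 2 :=
          sq_le_sq' (neg_le_of_abs_le (Complex.abs_re_le_norm _)) (Complex.re_le_norm _)
      _ ≤ vecSq (conjVec (u k)) * vecSq (nonlinearTerm u k p) := norm_dot_sq_le _ _
      _ ≤ _ := by
        rw [vecSq_conjVec]
        exact mul_le_mul_of_nonneg_left hN (vecSq_nonneg _)
  calc transferTerm u k p ^ 2
      = normSq k ^ 2 * (dot (conjVec (u k)) (nonlinearTerm u k p)).re ^ 2 := mul_pow _ _ _
    _ ≤ normSq k ^ 2 * (vecSq (u k) * (normSq (k - p) * (vecSq (u p) * vecSq (u (k - p))))) :=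
      mul_le_mul_of_nonneg_left hre (sq_nonneg _)
    _ = _ := by ring

/-! ### Orbits and the Frobenius norm of the stretching matrix -/

theorem card_orbitModes_pos {N : ℕ} (α : Orbit N) : 0 < (orbitModes α).card := by
  obtain ⟨k, hk⟩ := Quotient.exists_rep (s := orbitSetoid N) α
  rw [Finset.card_pos]
  exact ⟨k, by simp only [orbitModes, Finset.mem_map]; exact ⟨k, by simpa using hk, rfl⟩⟩

theorem card_orbitModes_le {N : ℕ} (α : Orbit N) : (orbitModes α).card ≤ 48 := by
  classical
  obtain ⟨k, hk⟩ := Quotient.exists_rep (s := orbitSetoid N) α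
  have hsub : orbitModes α ⊆ (Finset.univ : Finset (Equiv.Perm (Fin 3) × (Fin 3 → ℤˣ))).image
      fun g => fun i => (g.2 i : ℤ) * (k : Wave) (g.1 i) := by
    intro l hl
    simp only [orbitModes, Finset.mem_map, Finset.mem_filter, Finset.mem_univ, true_and] at hl
    obtain ⟨l', hl', rfl⟩ := hl
    obtain ⟨σ, ε, h⟩ : SameOrbit k l' := Quotient.exact (hk.trans hl'.symm)
    simp only [Finset.mem_image, Finset.mem_univ, true_and, Prod.exists]
    exact ⟨σ, ε, by funext i; exact (h i).symm⟩
  have hcard : Fintype.card (Equiv.Perm (Fin 3) × (Fin 3 → ℤˣ)) = 48 := by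
    rw [Fintype.card_prod, Fintype.card_perm, Fintype.card_fun, Fintype.card_fin,
      Fintype.card_units_int]
    rfl
  calc (orbitModes α).card ≤ _ := Finset.card_le_card hsub
    _ ≤ (Finset.univ : Finset (Equiv.Perm (Fin 3) × (Fin 3 → ℤˣ))).card := Finset.card_image_le
    _ = 48 := by rw [Finset.card_univ, hcard]

theorem sum_orbitModes {N : ℕ} (f : Wave → ℝ) :
    ∑ α : Orbit N, ∑ k ∈ orbitModes α, f k = ∑ k ∈ lattice N, f k := by
  classical
  simp only [orbitModes, Finset.sum_map, Function.Embedding.subtype_apply, Finset.sum_filter]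
  rw [← Finset.sum_coe_sort (lattice N), Finset.sum_comm]
  refine Finset.sum_congr rfl fun k _ => ?_
  refine (Finset.sum_eq_single (Quotient.mk (orbitSetoid N) k : Orbit N) ?_ ?_).trans
    (if_pos rfl)
  · intro α _ hα
    exact if_neg (Ne.symm hα)
  · intro h
    exact (h (Finset.mem_univ (α := Orbit N) _)).elim

theorem inv_mul_sq_le_of_sq_le {a b c Q s : ℝ} (ha : 1 ≤ a) (hb : 0 ≤ b) (hbc : b ≤ c)
    (hQ : 0 ≤ Q) (hs : s ^ 2 ≤ a * b * Q) : (a⁻¹ * s) ^ 2 ≤ c * Q := by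
  have ha0 : 0 < a := by linarith
  calc (a⁻¹ * s) ^ 2 = a⁻¹ ^ 2 * s ^ 2 := mul_pow _ _ _
    _ ≤ a⁻¹ ^ 2 * (a * b * Q) := by gcongr
    _ = a⁻¹ * b * Q := by field_simp
    _ ≤ 1 * c * Q := by
      gcongr
      exact inv_le_one_of_one_le₀ ha
    _ = c * Q := by ring

theorem transferMatrix_sq_le (N : ℕ) (u : Wave → CVec) (α β : Orbit N) :
    transferMatrix N u α β ^ 2 ≤ 48 * ∑ k ∈ orbitModes α, ∑ p ∈ orbitModes β,
      if k - p ∈ lattice N then transferTerm u k p ^ 2 else 0 := by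
  set t : Wave → Wave → ℝ := fun k p => if k - p ∈ lattice N then transferTerm u k p else 0
  have hS : transferMatrix N u α β = ((orbitModes α).card : ℝ)⁻¹ *
      ∑ x ∈ orbitModes α ×ˢ orbitModes β, t x.1 x.2 := by
    rw [Finset.sum_product]
    simp only [transferMatrix, Matrix.of_apply, Finset.sum_filter, t, transferTerm]
  have ht : ∀ k p, (if k - p ∈ lattice N then transferTerm u k p ^ 2 else 0) = t k p ^ 2 := by
    intro k p; simp only [t]; split_ifs <;> simp
  simp only [ht]
  rw [hS, ← Finset.sum_product']
  refine inv_mul_sq_le_of_sq_le (b := ((orbitModes β).card : ℝ)) ?_ (Nat.cast_nonneg _) ?_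
    (Finset.sum_nonneg fun _ _ => sq_nonneg _) ?_
  · exact_mod_cast card_orbitModes_pos α
  · exact_mod_cast card_orbitModes_le β
  · have := sq_sum_le_card_mul_sum_sq (s := orbitModes α ×ˢ orbitModes β)
      (f := fun x => t x.1 x.2)
    rwa [Finset.card_product, Nat.cast_mul] at this

/-- The squared spectral radius is bounded by the sum of the squares of all transfer terms. -/
theorem stretchingRadius_sq_le (N : ℕ) (u : Wave → CVec) :
    stretchingRadius N u ^ 2 ≤ 48 * ∑ k ∈ lattice N, ∑ p ∈ lattice N,
      if k - p ∈ lattice N then transferTerm u k p ^ 2 else 0 := by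
  have h1 : stretchingRadius N u ^ 2 ≤ ∑ α, ∑ β, transferMatrix N u α β ^ 2 := by
    refine (sq_toReal_spectralRadius_le _).trans ?_
    have hsymm : ∑ α, ∑ β, transferMatrix N u β α ^ 2 = ∑ α, ∑ β, transferMatrix N u α β ^ 2 :=
      Finset.sum_comm
    calc _ ≤ ∑ α, ∑ β, ((transferMatrix N u α β ^ 2 + transferMatrix N u β α ^ 2) / 2) := by
          refine Finset.sum_le_sum fun α _ => Finset.sum_le_sum fun β _ => ?_
          simp only [Matrix.map_apply, stretchingMatrix, Matrix.of_apply, Complex.norm_real,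
            Real.norm_eq_abs, sq_abs]
          nlinarith [sq_nonneg (transferMatrix N u α β - transferMatrix N u β α)]
      _ = _ := by
          simp only [add_div, Finset.sum_add_distrib, ← Finset.sum_div]
          rw [hsymm]; ring
  refine h1.trans ((Finset.sum_le_sum fun α _ => Finset.sum_le_sum fun β _ =>
    transferMatrix_sq_le N u α β).trans_eq ?_)
  simp only [← Finset.mul_sum]
  congr 1
  have h2 : ∀ α : Orbit N, (∑ β : Orbit N, ∑ k ∈ orbitModes α, ∑ p ∈ orbitModes β,
      if k - p ∈ lattice N then transferTerm u k p ^ 2 else 0) =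
      ∑ k ∈ orbitModes α, ∑ p ∈ lattice N,
        if k - p ∈ lattice N then transferTerm u k p ^ 2 else 0 := by
    intro α
    rw [Finset.sum_comm]
    exact Finset.sum_congr rfl fun k _ => sum_orbitModes fun p =>
      if k - p ∈ lattice N then transferTerm u k p ^ 2 else 0
  simp only [h2]
  exact sum_orbitModes _

/-! ### Inverse moments of complex Gaussians -/

theorem gaussianReal_zero_half_le : gaussianReal 0 (1 / 2) ≤ (volume : Measure ℝ) := by
  refine Measure.le_iff.2 fun s _ => ?_
  rw [gaussianReal_apply _ (by simp)]
  calc ∫⁻ x in s, gaussianPDF 0 (1 / 2) x ≤ ∫⁻ _ in s, 1 := by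
        refine lintegral_mono fun x => ?_
        rw [gaussianPDF, ENNReal.ofReal_le_one, gaussianPDFReal]
        -- The maximum of the density is `1 / √π ≤ 1`.
        have h1 : 1 ≤ √(2 * Real.pi * ((1 / 2 : NNReal) : ℝ)) := by
          rw [Real.one_le_sqrt]
          push_cast
          linarith [Real.pi_gt_three]
        have h2 : Real.exp (-(x - 0) ^ 2 / (2 * ((1 / 2 : NNReal) : ℝ))) ≤ 1 := by
          rw [Real.exp_le_one_iff]
          exact div_nonpos_of_nonpos_of_nonneg (by nlinarith [sq_nonneg (x - 0)]) (by positivity)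
        exact mul_le_one₀ (inv_le_one_of_one_le₀ h1) (Real.exp_pos _).le h2
    _ = volume s := by simp

theorem stdComplexGaussian_le_volume : stdComplexGaussian ≤ (volume : Measure ℂ) := by
  rw [stdComplexGaussian, ← (Complex.volume_preserving_equiv_real_prod.symm).map_eq]
  exact Measure.map_mono (Measure.prod_mono gaussianReal_zero_half_le gaussianReal_zero_half_le)
    Complex.measurableEquivRealProd.symm.measurable

theorem setLIntegral_ball_enorm_rpow_lt_top :
    ∫⁻ z in Metric.ball (0 : ℂ) 1, ‖z‖ₑ ^ (-(3 / 2) : ℝ) < ⊤ := by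
  have h : IntegrableOn (fun z : ℂ => ‖z‖ ^ (-(3 / 2) : ℝ)) (Metric.ball 0 1) volume := by
    refine integrableOn_ball_of_norm_le_rpow (C := 1) (α := 3 / 2) ?_ ?_ ?_ ?_
    · simp
    · rw [Complex.finrank_real_complex]; norm_num
    · refine Filter.Eventually.of_forall fun z => ?_
      rw [one_mul, Real.norm_eq_abs, abs_of_nonneg (by positivity)]
    · exact (measurable_norm.pow_const _).aestronglyMeasurable
  refine lt_of_le_of_lt (lintegral_mono_ae ?_) h.2
  refine ae_restrict_of_ae ?_
  filter_upwards [compl_mem_ae_iff.2 (measure_singleton (0 : ℂ))] with z hz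
  have hz0 : 0 < ‖z‖ := norm_pos_iff.2 hz
  rw [← ofReal_norm, ENNReal.ofReal_rpow_of_pos hz0, ← ofReal_norm,
    Real.norm_eq_abs, abs_of_nonneg (by positivity)]

/-- The inverse moment of order `3/2` of a shifted complex Gaussian is bounded uniformly in the
shift, because the density is bounded. -/
theorem exists_lintegral_enorm_sub_rpow_le : ∃ K : ENNReal, K < ⊤ ∧ ∀ c : ℂ,
    ∫⁻ z, ‖z - c‖ₑ ^ (-(3 / 2) : ℝ) ∂stdComplexGaussian ≤ K := by
  refine ⟨(∫⁻ z in Metric.ball (0 : ℂ) 1, ‖z‖ₑ ^ (-(3 / 2) : ℝ)) + 1,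
    ENNReal.add_lt_top.2 ⟨setLIntegral_ball_enorm_rpow_lt_top, ENNReal.one_lt_top⟩,
    fun c => ?_⟩
  set g : ℂ → ENNReal := (Metric.ball (0 : ℂ) 1).indicator fun z => ‖z‖ₑ ^ (-(3 / 2) : ℝ) with hg
  have hmeas : Measurable fun z : ℂ => g (z - c) :=
    (((measurable_enorm.pow_const _).indicator measurableSet_ball).comp
      (measurable_id.sub_const c))
  have hle : ∀ z : ℂ, ‖z - c‖ₑ ^ (-(3 / 2) : ℝ) ≤ g (z - c) + 1 := by
    intro z
    by_cases hz : z - c ∈ Metric.ball (0 : ℂ) 1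
    · rw [hg, Set.indicator_of_mem hz]
      exact le_self_add
    · have h1 : (1 : ENNReal) ≤ ‖z - c‖ₑ := by
        rw [← ofReal_norm, ENNReal.one_le_ofReal]
        simpa using hz
      exact (ENNReal.rpow_le_one_of_one_le_of_neg h1 (by norm_num)).trans le_add_self
  calc ∫⁻ z, ‖z - c‖ₑ ^ (-(3 / 2) : ℝ) ∂stdComplexGaussian
      ≤ ∫⁻ z, (g (z - c) + 1) ∂stdComplexGaussian := lintegral_mono hle
    _ = (∫⁻ z, g (z - c) ∂stdComplexGaussian) + 1 := by
      rw [lintegral_add_left hmeas]; simp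
    _ ≤ (∫⁻ z, g (z - c)) + 1 := by
      gcongr
      exact stdComplexGaussian_le_volume
    _ = _ := by
      rw [lintegral_sub_right_eq_self g c, hg, lintegral_indicator measurableSet_ball]

/-- The law of the coordinates of a single mode. -/
noncomputable abbrev modeLaw : Measure CVec := Measure.pi fun _ => stdComplexGaussian

theorem exists_lintegral_enorm_modeLaw_le : ∃ K : ENNReal, K < ⊤ ∧ ∀ c : ℂ,
    ∫⁻ x, ‖x 1 - c * x 0‖ₑ ^ (-(3 / 2) : ℝ) ∂modeLaw ≤ K := by
  obtain ⟨K, hK, h⟩ := exists_lintegral_enorm_sub_rpow_le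
  refine ⟨K, hK, fun c => ?_⟩
  have hle := lintegral_le_of_lmarginal_le (μ := fun _ : Fin 3 => stdComplexGaussian) {1}
    (f := fun x : CVec => ‖x 1 - c * x 0‖ₑ ^ (-(3 / 2) : ℝ)) (g := fun _ => K)
    (by fun_prop) measurable_const ?_
  · simpa using hle
  · rw [lmarginal_singleton, lmarginal_singleton]
    intro x
    simpa using h (c * x 0)

/-! ### Sixth moments -/

theorem lintegral_norm_pow_six_lt_top :
    ∫⁻ z, ENNReal.ofReal (‖z‖ ^ 6) ∂stdComplexGaussian < ⊤ := by
  have hfin : ∫⁻ x, ENNReal.ofReal (x ^ 6) ∂gaussianReal 0 (1 / 2) < ⊤ := by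
    have h := (memLp_id_gaussianReal (μ := 0) (v := 1 / 2) 6).integrable_norm_pow (by norm_num)
    refine lt_of_le_of_lt (lintegral_mono fun x => ?_) h.2
    rw [← ofReal_norm]
    refine ENNReal.ofReal_le_ofReal ?_
    simp only [id, norm_pow, norm_norm]
    exact (le_abs_self _).trans_eq (by simp [abs_pow])
  have hm : Measurable fun x : ℝ => ENNReal.ofReal (x ^ 6) := by fun_prop
  rw [stdComplexGaussian, lintegral_map (by fun_prop) (by fun_prop)]
  calc _ ≤ ∫⁻ x : ℝ × ℝ, 4 * (ENNReal.ofReal (x.1 ^ 6) + ENNReal.ofReal (x.2 ^ 6))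
        ∂((gaussianReal 0 (1 / 2)).prod (gaussianReal 0 (1 / 2))) := by
        refine lintegral_mono fun x => ?_
        have h4 : (4 : ENNReal) = ENNReal.ofReal 4 := by simp
        rw [← ENNReal.ofReal_add (by positivity) (by positivity), h4,
          ← ENNReal.ofReal_mul (by norm_num)]
        refine ENNReal.ofReal_le_ofReal ?_
        have h6 : ‖Complex.measurableEquivRealProd.symm x‖ ^ 6 = (x.1 ^ 2 + x.2 ^ 2) ^ 3 := by
          rw [show (6 : ℕ) = 2 * 3 from rfl, pow_mul, Complex.sq_norm, Complex.normSq_apply]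
          simp [Complex.measurableEquivRealProd_symm_apply, sq]
        rw [h6]
        nlinarith [mul_nonneg (add_nonneg (sq_nonneg x.1) (sq_nonneg x.2))
          (sq_nonneg (x.1 ^ 2 - x.2 ^ 2))]
    _ < ⊤ := by
        rw [lintegral_const_mul _ (by fun_prop), lintegral_add_left (by fun_prop),
          lintegral_prod _ (by fun_prop), lintegral_prod _ (by fun_prop)]
        simp only [lintegral_const, measure_univ, mul_one]
        exact ENNReal.mul_lt_top (by simp) (ENNReal.add_lt_top.2 ⟨hfin, hfin⟩)

theorem measurable_vecSq : Measurable vecSq := by unfold vecSq; fun_prop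

theorem lintegral_vecSq_pow_three_lt_top :
    ∫⁻ x, ENNReal.ofReal (vecSq x ^ 3) ∂modeLaw < ⊤ := by
  calc _ ≤ ∫⁻ x : CVec, ∑ i, 9 * ENNReal.ofReal (‖x i‖ ^ 6) ∂modeLaw := by
        refine lintegral_mono fun x => ?_
        have h9 : (9 : ENNReal) = ENNReal.ofReal 9 := by simp
        simp only [h9, ← ENNReal.ofReal_mul (show (0 : ℝ) ≤ 9 by norm_num)]
        rw [← ENNReal.ofReal_sum_of_nonneg fun i _ => by positivity]
        refine ENNReal.ofReal_le_ofReal ?_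
        have h := pow_sum_le_card_mul_sum_pow (s := Finset.univ) (f := fun i => ‖x i‖ ^ 2)
          (fun i _ => by positivity) 2
        simp only [← pow_mul, Finset.card_univ, Fintype.card_fin] at h
        rw [← Finset.mul_sum]
        refine h.trans_eq ?_
        norm_num
    _ < ⊤ := by
        rw [lintegral_finsetSum _ fun i _ => by fun_prop]
        refine ENNReal.sum_lt_top.2 fun i _ => ?_
        rw [lintegral_const_mul _ (by fun_prop)]
        refine ENNReal.mul_lt_top (by simp) ?_
        have h := (measurePreserving_eval (fun _ : Fin 3 => stdComplexGaussian) i).lintegral_comp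
          (f := fun z : ℂ => ENNReal.ofReal (‖z‖ ^ 6)) (by fun_prop)
        exact h.trans_lt lintegral_norm_pow_six_lt_top

/-! ### Lattice counts -/

theorem mem_lattice_iff {N : ℕ} {k : Wave} :
    k ∈ lattice N ↔ k ≠ 0 ∧ ∀ i, -(N : ℤ) ≤ k i ∧ k i ≤ N := by
  simp [lattice, Fintype.mem_piFinset]

theorem card_lattice_add_one (N : ℕ) : (lattice N).card + 1 = (2 * N + 1) ^ 3 := by
  rw [lattice, Finset.card_erase_add_one]
  · rw [Fintype.card_piFinset, Finset.prod_const]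
    simp only [Int.card_Icc, Finset.card_univ, Fintype.card_fin]
    congr 1
    omega
  · simp [Fintype.mem_piFinset]

theorem card_lattice_le {N : ℕ} (hN : 1 ≤ N) : ((lattice N).card : ℝ) ≤ 27 * (N : ℝ) ^ 3 := by
  have h : (lattice N).card ≤ 27 * N ^ 3 := by
    calc (lattice N).card ≤ (2 * N + 1) ^ 3 := by have := card_lattice_add_one N; omega
      _ ≤ (3 * N) ^ 3 := Nat.pow_le_pow_left (by omega) 3
      _ = 27 * N ^ 3 := by ring
  exact_mod_cast h

theorem sq_le_normSq (k : Wave) (i : Fin 3) : (k i : ℝ) ^ 2 ≤ normSq k :=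
  Finset.single_le_sum (f := fun i => (k i : ℝ) ^ 2) (fun _ _ => sq_nonneg _) (Finset.mem_univ i)

theorem one_le_normSq {k : Wave} (hk : k ≠ 0) : 1 ≤ normSq k := by
  obtain ⟨i, hi⟩ := Function.ne_iff.1 hk
  refine le_trans ?_ (sq_le_normSq k i)
  have h : 1 ≤ (k i) ^ 2 := Int.add_one_le_of_lt (sq_pos_of_ne_zero hi)
  exact_mod_cast h

theorem normSq_le {N : ℕ} {k : Wave} (hk : k ∈ lattice N) : normSq k ≤ 3 * (N : ℝ) ^ 2 := by
  calc normSq k ≤ ∑ _i : Fin 3, (N : ℝ) ^ 2 := by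
        refine Finset.sum_le_sum fun i _ => ?_
        have h := (mem_lattice_iff.1 hk).2 i
        have h1 : -(N : ℝ) ≤ k i := by exact_mod_cast h.1
        have h2 : (k i : ℝ) ≤ N := by exact_mod_cast h.2
        exact sq_le_sq' h1 h2
    _ = 3 * (N : ℝ) ^ 2 := by simp

theorem normSq_neg (k : Wave) : normSq (-k) = normSq k := by simp [normSq]

/-- The lattice sum `∑ |p|⁻²` grows linearly: the cube shell `|p|_∞ = N` has at most `26 N²`
points, each contributing at most `N⁻²`. -/
theorem sum_inv_normSq_le (N : ℕ) : ∑ p ∈ lattice N, (normSq p)⁻¹ ≤ 26 * (N : ℝ) := by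
  induction N with
  | zero =>
    have h := card_lattice_add_one 0
    have h0 : lattice 0 = ∅ := Finset.card_eq_zero.1 (by omega)
    simp [h0]
  | succ N ih =>
    have hsub : lattice N ⊆ lattice (N + 1) := by
      intro k hk
      rw [mem_lattice_iff] at hk ⊢
      exact ⟨hk.1, fun i => ⟨by have := (hk.2 i).1; push_cast; omega,
        by have := (hk.2 i).2; push_cast; omega⟩⟩
    have hshell : ∀ p ∈ lattice (N + 1) \ lattice N,
        (normSq p)⁻¹ ≤ (((N : ℝ) + 1) ^ 2)⁻¹ := by
      intro p hp
      rw [Finset.mem_sdiff, mem_lattice_iff (N := N)] at hp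
      have hp0 := (mem_lattice_iff.1 hp.1).1
      obtain ⟨i, hi⟩ : ∃ i, ¬(-(N : ℤ) ≤ p i ∧ p i ≤ N) := by
        by_contra! hcon
        exact hp.2 ⟨hp0, hcon⟩
      have habs : (N : ℤ) + 1 ≤ |p i| := by
        rcases abs_cases (p i) with h | h <;> omega
      have habs' : (N : ℝ) + 1 ≤ |(p i : ℝ)| := by exact_mod_cast habs
      refine inv_anti₀ (by positivity) (le_trans ?_ (sq_le_normSq p i))
      rw [← sq_abs (p i : ℝ)]
      gcongr
    have hcard : ((lattice (N + 1) \ lattice N).card : ℝ) ≤ 26 * ((N : ℝ) + 1) ^ 2 := by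
      have h1 := card_lattice_add_one N
      have h2 := card_lattice_add_one (N + 1)
      have h3 := Finset.card_sdiff_add_card_eq_card hsub
      have h4 : (lattice (N + 1) \ lattice N).card + (2 * N + 1) ^ 3 = (2 * (N + 1) + 1) ^ 3 := by
        omega
      have h5 : ((lattice (N + 1) \ lattice N).card : ℝ) + (2 * N + 1) ^ 3 =
          (2 * (N + 1) + 1) ^ 3 := by exact_mod_cast h4
      nlinarith [Nat.cast_nonneg (α := ℝ) N]
    rw [← Finset.sum_sdiff hsub]
    calc _ ≤ ∑ _p ∈ lattice (N + 1) \ lattice N, (((N : ℝ) + 1) ^ 2)⁻¹ + 26 * (N : ℝ) :=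
          add_le_add (Finset.sum_le_sum hshell) ih
      _ ≤ 26 * ((N : ℝ) + 1) ^ 2 * (((N : ℝ) + 1) ^ 2)⁻¹ + 26 * (N : ℝ) := by
          rw [Finset.sum_const, nsmul_eq_mul]
          gcongr
      _ = 26 * ((N + 1 : ℕ) : ℝ) := by
          have : ((N : ℝ) + 1) ^ 2 ≠ 0 := by positivity
          field_simp
          push_cast
          ring

/-! ### The field in terms of its Gaussian coordinates -/

open Classical in
/-- The squared length `|X_k|²` of the Gaussian coordinate that determines the mode `k`: the
coordinate with index `k` or `-k`, whichever is chosen, and `0` if there is none. -/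
noncomputable def modeSq (N : ℕ) (X : Coordinates N) (k : Wave) : ℝ :=
  if h : k ∈ halfLattice N then vecSq (X ⟨k, h⟩)
  else if h : -k ∈ halfLattice N then vecSq (X ⟨-k, h⟩)
  else 0

theorem modeSq_nonneg (N : ℕ) (X : Coordinates N) (k : Wave) : 0 ≤ modeSq N X k := by
  unfold modeSq
  split_ifs
  exacts [vecSq_nonneg _, vecSq_nonneg _, le_rfl]

theorem norm_inv_sqrt_pow_sq (a : ℕ) (k : Wave) :
    ‖((Real.sqrt (normSq k) ^ a : ℝ) : ℂ)⁻¹‖ ^ 2 = (normSq k ^ a)⁻¹ := by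
  rw [norm_inv, Complex.norm_real, Real.norm_eq_abs, abs_of_nonneg (by positivity), inv_pow,
    ← pow_mul, mul_comm, pow_mul, Real.sq_sqrt (normSq_nonneg k)]

theorem vecSq_rawField_le (N a : ℕ) (X : Coordinates N) (k : Wave) :
    vecSq (rawField N a X k) ≤ (normSq k ^ a)⁻¹ * modeSq N X k := by
  have h0 : 0 ≤ (normSq k ^ a)⁻¹ := inv_nonneg.2 (pow_nonneg (normSq_nonneg k) a)
  unfold rawField modeSq
  split_ifs with h1 h2
  · rw [vecSq_mul, norm_inv_sqrt_pow_sq]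
    exact mul_le_mul_of_nonneg_left (vecSq_leray_le _ _) h0
  · rw [vecSq_conjVec, vecSq_mul, norm_inv_sqrt_pow_sq, normSq_neg]
    exact mul_le_mul_of_nonneg_left (vecSq_leray_le _ _) h0
  · simp [vecSq]

theorem energy_nonneg (N : ℕ) (v : Wave → CVec) : 0 ≤ energy N v := by
  unfold energy
  refine mul_nonneg (by norm_num) (Finset.sum_nonneg fun k _ => mul_nonneg (normSq_nonneg k) ?_)
  positivity

/-- If the energy vanishes, both sides are `0`, because `x / 0 = 0`. -/
theorem vecSq_ensembleField (N a : ℕ) (X : Coordinates N) (k : Wave) :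
    vecSq (ensembleField N a X k) =
      vecSq (rawField N a X k) * (energy N (rawField N a X))⁻¹ := by
  have h : ensembleField N a X k =
      fun i => ((Real.sqrt (energy N (rawField N a X)) : ℂ))⁻¹ * rawField N a X k i := by
    funext i
    rw [ensembleField, div_eq_inv_mul]
  rw [h, vecSq_mul, norm_inv, Complex.norm_real, Real.norm_eq_abs,
    abs_of_nonneg (Real.sqrt_nonneg _), inv_pow, Real.sq_sqrt (energy_nonneg _ _), mul_comm]

/-- The deterministic factor with which `|X_k|² |X_p|² |X_{k-p}|²` bounds the squared transfer
term of `(k, p)`, before normalization. -/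
noncomputable def pairWeight (N a : ℕ) (k p : Wave) : ℝ :=
  if k - p ∈ lattice N then
    normSq k ^ 2 * normSq (k - p) *
      ((normSq k ^ a)⁻¹ * (normSq p ^ a)⁻¹ * (normSq (k - p) ^ a)⁻¹)
  else 0

theorem pairWeight_nonneg (N a : ℕ) (k p : Wave) : 0 ≤ pairWeight N a k p := by
  unfold pairWeight
  have := normSq_nonneg k
  have := normSq_nonneg p
  have := normSq_nonneg (k - p)
  split_ifs <;> positivity

theorem stretchingRadius_ensembleField_sq_le (N a : ℕ) (X : Coordinates N) :
    stretchingRadius N (ensembleField N a X) ^ 2 ≤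
      (48 * ∑ k ∈ lattice N, ∑ p ∈ lattice N,
        pairWeight N a k p * (modeSq N X k * modeSq N X p * modeSq N X (k - p))) *
      (energy N (rawField N a X))⁻¹ ^ 3 := by
  set W := energy N (rawField N a X) with hW
  have hW0 : 0 ≤ W := energy_nonneg _ _
  refine (stretchingRadius_sq_le N _).trans ?_
  rw [mul_assoc, Finset.sum_mul]
  refine mul_le_mul_of_nonneg_left ?_ (by norm_num)
  refine Finset.sum_le_sum fun k _ => ?_
  rw [Finset.sum_mul]
  refine Finset.sum_le_sum fun p _ => ?_
  unfold pairWeight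
  split_ifs with h
  · refine (transferTerm_sq_le _ k p).trans ?_
    simp only [vecSq_ensembleField, ← hW]
    have hk := vecSq_rawField_le N a X k
    have hp := vecSq_rawField_le N a X p
    have hq := vecSq_rawField_le N a X (k - p)
    have hk0 := vecSq_nonneg (rawField N a X k)
    have hp0 := vecSq_nonneg (rawField N a X p)
    have hq0 := vecSq_nonneg (rawField N a X (k - p))
    have hn := normSq_nonneg (k - p)
    calc _ = normSq k ^ 2 * normSq (k - p) * (vecSq (rawField N a X k) *
          vecSq (rawField N a X p) * vecSq (rawField N a X (k - p))) * W⁻¹ ^ 3 := by ring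
      _ ≤ normSq k ^ 2 * normSq (k - p) * (((normSq k ^ a)⁻¹ * modeSq N X k) *
          ((normSq p ^ a)⁻¹ * modeSq N X p) *
          ((normSq (k - p) ^ a)⁻¹ * modeSq N X (k - p))) * W⁻¹ ^ 3 := by
        gcongr
        · exact mul_nonneg (hk0.trans hk) (hp0.trans hp)
        · exact hk0.trans hk
      _ = _ := by ring
  · simp

/-- For both ensembles the total weight is of order `N^{12 - 6a}`. -/
theorem sum_pairWeight_le {N a : ℕ} (hN : 1 ≤ N) (ha : a = 0 ∨ a = 1) :
    ∑ k ∈ lattice N, ∑ p ∈ lattice N, pairWeight N a k p ≤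
      19683 * (N : ℝ) ^ (12 - 6 * a) := by
  have hcard := card_lattice_le hN
  rcases ha with rfl | rfl
  · calc _ ≤ ∑ _k ∈ lattice N, ∑ _p ∈ lattice N, (3 * (N : ℝ) ^ 2) ^ 2 * (3 * (N : ℝ) ^ 2) := by
          refine Finset.sum_le_sum fun k hk => Finset.sum_le_sum fun p _ => ?_
          unfold pairWeight
          split_ifs with h
          · have := normSq_le hk
            have := normSq_le h
            have := normSq_nonneg k
            have := normSq_nonneg (k - p)
            simp only [pow_zero, inv_one, mul_one]
            gcongr
          · positivity
      _ = (lattice N).card ^ 2 * (27 * (N : ℝ) ^ 6) := by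
          simp only [Finset.sum_const, nsmul_eq_mul]; ring
      _ ≤ (27 * (N : ℝ) ^ 3) ^ 2 * (27 * (N : ℝ) ^ 6) := by gcongr
      _ = _ := by norm_num; ring
  · calc _ ≤ ∑ _k ∈ lattice N, ∑ p ∈ lattice N, (3 * (N : ℝ) ^ 2) * (normSq p)⁻¹ := by
          refine Finset.sum_le_sum fun k hk => Finset.sum_le_sum fun p _ => ?_
          have hp := normSq_nonneg p
          unfold pairWeight
          split_ifs with h
          · have h1 := normSq_le hk
            have h2 : normSq k ≠ 0 := by
              have := one_le_normSq (mem_lattice_iff.1 hk).1; positivity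
            have h3 : normSq (k - p) ≠ 0 := by
              have := one_le_normSq (mem_lattice_iff.1 h).1; positivity
            calc _ = normSq k * (normSq p)⁻¹ := by
                  simp only [pow_one]; field_simp
              _ ≤ _ := by gcongr
          · positivity
      _ = (lattice N).card * ((3 * (N : ℝ) ^ 2) * ∑ p ∈ lattice N, (normSq p)⁻¹) := by
          rw [Finset.sum_const, nsmul_eq_mul, ← Finset.mul_sum]
      _ ≤ (27 * (N : ℝ) ^ 3) * ((3 * (N : ℝ) ^ 2) * (26 * (N : ℝ))) := by
          have hsum := sum_inv_normSq_le N
          have h0 : 0 ≤ ∑ p ∈ lattice N, (normSq p)⁻¹ :=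
            Finset.sum_nonneg fun p _ => inv_nonneg.2 (normSq_nonneg p)
          gcongr
      _ = 2106 * (N : ℝ) ^ (12 - 6 * 1) := by norm_num; ring
      _ ≤ _ := by gcongr; norm_num

/-! ### Inverse moments of the energy -/

theorem norm_sq_sub_le_vecSq_leray {k : Wave} (hk : 0 < k 0) (h1 : |k 1| ≤ k 0) (x : CVec) :
    ‖x 1 - ((k 1 : ℂ) / (k 0 : ℂ)) * x 0‖ ^ 2 ≤ 2 * vecSq (leray k x) := by
  have hk0 : (k 0 : ℂ) ≠ 0 := by exact_mod_cast hk.ne'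
  -- `k` and its multiples cancel in `k₀ v₁ - k₁ v₀`, so `v` may be replaced by `P(k)v`.
  have hrw : x 1 - ((k 1 : ℂ) / (k 0 : ℂ)) * x 0 =
      leray k x 1 - ((k 1 : ℂ) / (k 0 : ℂ)) * leray k x 0 := by
    unfold leray
    field_simp
    ring
  have hq : ‖(k 1 : ℂ) / (k 0 : ℂ)‖ ≤ 1 := by
    rw [norm_div, Complex.norm_intCast, Complex.norm_intCast]
    refine div_le_one_of_le₀ ?_ (abs_nonneg _)
    exact_mod_cast h1.trans (le_abs_self _)
  have hn : ‖x 1 - ((k 1 : ℂ) / (k 0 : ℂ)) * x 0‖ ≤ ‖leray k x 1‖ + ‖leray k x 0‖ := by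
    rw [hrw]
    refine (norm_sub_le _ _).trans ?_
    rw [norm_mul]
    gcongr
    exact mul_le_of_le_one_left (norm_nonneg _) hq
  calc _ ≤ (‖leray k x 1‖ + ‖leray k x 0‖) ^ 2 := by gcongr
    _ ≤ 2 * vecSq (leray k x) := by
      simp only [vecSq, Fin.sum_univ_three]
      nlinarith [sq_nonneg (‖leray k x 1‖ - ‖leray k x 0‖), sq_nonneg ‖leray k x 2‖]

/-- The index set of the groups of modes: a cube of side `⌈N/2⌉`. -/
abbrev GroupIndex (N : ℕ) : Type :=
  Fin ((N + 1) / 2) × Fin ((N + 1) / 2) × Fin ((N + 1) / 2)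

/-- A family of disjoint groups of four modes in the half-lattice. Every member has a first
coordinate `≥ N/2` that dominates the other two. -/
def probeMode (N : ℕ) (t : GroupIndex N) (s : ℤˣ × ℤˣ) : Wave :=
  ![N - (t.1 : ℤ), (s.1 : ℤ) * ((t.2.1 : ℤ) + 1), (s.2 : ℤ) * ((t.2.2 : ℤ) + 1)]

theorem probeMode_bounds (N : ℕ) (t : GroupIndex N) (s : ℤˣ × ℤˣ) :
    0 < probeMode N t s 0 ∧ (N : ℤ) ≤ 2 * probeMode N t s 0 ∧ probeMode N t s 0 ≤ N ∧
      |probeMode N t s 1| ≤ probeMode N t s 0 ∧ |probeMode N t s 2| ≤ probeMode N t s 0 := by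
  obtain ⟨i, j, l⟩ := t
  have hi := i.2
  have hj := j.2
  have hl := l.2
  have habs : ∀ (e : ℤˣ) (m : ℕ), |(e : ℤ) * ((m : ℤ) + 1)| = (m : ℤ) + 1 := by
    intro e m
    rw [abs_mul, Int.abs_eq_natAbs (e : ℤ), Int.units_natAbs, Nat.cast_one, one_mul,
      abs_of_nonneg (by positivity)]
  simp only [probeMode, Matrix.cons_val_zero, Matrix.cons_val_one, Matrix.cons_val, habs]
  omega

theorem probeMode_mem_lattice (N : ℕ) (t : GroupIndex N) (s : ℤˣ × ℤˣ) :
    probeMode N t s ∈ lattice N := by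
  obtain ⟨h0, -, h2, h3, h4⟩ := probeMode_bounds N t s
  rw [mem_lattice_iff]
  refine ⟨fun h => by simp [h] at h0, fun i => ?_⟩
  rw [abs_le] at h3 h4
  fin_cases i
  · simp only [Fin.zero_eta]; omega
  · simp only [Fin.mk_one]; omega
  · simp only [Fin.reduceFinMk]; omega

theorem probeMode_mem_halfLattice (N : ℕ) (t : GroupIndex N) (s : ℤˣ × ℤˣ) :
    probeMode N t s ∈ halfLattice N := by
  classical
  exact Finset.mem_filter.2 ⟨probeMode_mem_lattice N t s, Or.inl (probeMode_bounds N t s).1⟩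

theorem probeMode_injective (N : ℕ) :
    Function.Injective fun x : GroupIndex N × (ℤˣ × ℤˣ) => probeMode N x.1 x.2 := by
  rintro ⟨⟨i, j, l⟩, ⟨e, f⟩⟩ ⟨⟨i', j', l'⟩, ⟨e', f'⟩⟩ h
  have hsign : ∀ (e e' : ℤˣ) (m m' : ℕ), (e : ℤ) * ((m : ℤ) + 1) = (e' : ℤ) * ((m' : ℤ) + 1) →
      e = e' ∧ m = m' := by
    intro e e' m m' h
    rcases Int.units_eq_one_or e with rfl | rfl <;> rcases Int.units_eq_one_or e' with rfl | rfl <;>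
      simp only [Units.val_one, Units.val_neg, neg_mul, one_mul] at h
    · exact ⟨rfl, by omega⟩
    · omega
    · omega
    · exact ⟨rfl, by omega⟩
  have h0 := congrFun h 0
  have h1 := hsign _ _ _ _ (congrFun h 1)
  have h2 := hsign _ _ _ _ (congrFun h 2)
  simp only [probeMode, Matrix.cons_val_zero] at h0
  simp only [Prod.mk.injEq, Fin.ext_iff]
  refine ⟨⟨by omega, h1.2, h2.2⟩, h1.1, h2.1⟩

/-- The combination `x₁ - (k₁/k₀) x₀` of the coordinates `x` of the mode `k = probeMode N t s`,
which does not change when `x` is replaced by `P(k)x`. -/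
noncomputable def probeValue (N : ℕ) (X : Coordinates N) (t : GroupIndex N) (s : ℤˣ × ℤˣ) : ℂ :=
  X ⟨probeMode N t s, probeMode_mem_halfLattice N t s⟩ 1 -
    ((probeMode N t s 1 : ℂ) / (probeMode N t s 0 : ℂ)) *
      X ⟨probeMode N t s, probeMode_mem_halfLattice N t s⟩ 0

theorem sum_probeValue_le_energy {N a : ℕ} (ha : a = 0 ∨ a = 1) (X : Coordinates N) :
    (N : ℝ) ^ (2 - 2 * a) / 16 * ∑ t, ∑ s, ‖probeValue N X t s‖ ^ 2 ≤
      energy N (rawField N a X) := by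
  set e : Wave → ℝ := fun k => normSq k * vecSq (rawField N a X k) with he
  have he0 : ∀ k, 0 ≤ e k := fun k => mul_nonneg (normSq_nonneg k) (vecSq_nonneg _)
  have hterm : ∀ t s, (N : ℝ) ^ (2 - 2 * a) / 8 * ‖probeValue N X t s‖ ^ 2 ≤
      e (probeMode N t s) := by
    intro t s
    obtain ⟨h0, h1, -, h3, -⟩ := probeMode_bounds N t s
    have hmem := probeMode_mem_halfLattice N t s
    have hz := norm_sq_sub_le_vecSq_leray h0 h3 (X ⟨_, hmem⟩)
    set k := probeMode N t s with hk
    have hraw : vecSq (rawField N a X k) = (normSq k ^ a)⁻¹ * vecSq (leray k (X ⟨k, hmem⟩)) := by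
      unfold rawField
      rw [dif_pos hmem, vecSq_mul, norm_inv_sqrt_pow_sq]
    have hk1 : 1 ≤ normSq k := one_le_normSq fun h => by rw [h] at h0; simp at h0
    have hsq : (N : ℝ) ^ 2 ≤ 4 * normSq k := by
      have h1' : (N : ℝ) ≤ 2 * (k 0 : ℝ) := by exact_mod_cast h1
      have := sq_le_normSq k 0
      nlinarith [Nat.cast_nonneg (α := ℝ) N]
    have hv := vecSq_nonneg (leray k (X ⟨k, hmem⟩))
    simp only [he, hraw]
    change _ * ‖_‖ ^ 2 ≤ _
    rcases ha with rfl | rfl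
    · simp only [mul_zero, Nat.sub_zero, pow_zero, inv_one, one_mul]
      calc _ ≤ (4 * normSq k) / 8 * (2 * vecSq (leray k (X ⟨k, hmem⟩))) := by
            gcongr
            exact hz
        _ = _ := by ring
    · simp only [mul_one, Nat.sub_self, pow_zero, pow_one]
      rw [mul_inv_cancel_left₀ (by positivity)]
      have : ‖probeValue N X t s‖ ^ 2 ≤ 2 * vecSq (leray k (X ⟨k, hmem⟩)) := hz
      linarith
  have hsum : ∑ x : GroupIndex N × (ℤˣ × ℤˣ), e (probeMode N x.1 x.2) ≤
      ∑ k ∈ lattice N, e k := by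
    classical
    rw [← Finset.sum_image (f := e) (s := Finset.univ) (g := fun x : GroupIndex N × (ℤˣ × ℤˣ) =>
      probeMode N x.1 x.2) fun x _ y _ h => probeMode_injective N h]
    refine Finset.sum_le_sum_of_subset_of_nonneg ?_ fun k _ _ => he0 k
    intro k hk
    obtain ⟨x, -, rfl⟩ := Finset.mem_image.1 hk
    exact probeMode_mem_lattice N x.1 x.2
  rw [Fintype.sum_prod_type] at hsum
  calc _ = (1 / 2) * ∑ t, ∑ s, (N : ℝ) ^ (2 - 2 * a) / 8 * ‖probeValue N X t s‖ ^ 2 := by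
        simp only [← Finset.mul_sum]; ring
    _ ≤ (1 / 2) * ∑ t, ∑ s, e (probeMode N t s) := by
        gcongr with t _ s _
        exact hterm t s
    _ ≤ (1 / 2) * ∑ k ∈ lattice N, e k := by gcongr
    _ = energy N (rawField N a X) := rfl

/-- For four positive numbers, the inverse cube of the sum of squares is at most the product of
the powers `y_s^{-3/2}`, by the inequality between arithmetic and geometric mean. -/
theorem inv_sum_sq_pow_three_le_prod {S : Type*} [Fintype S] (hS : Fintype.card S = 4)
    {y : S → ℝ} (hy : ∀ s, 0 < y s) :
    (∑ s, y s ^ 2) ^ (-3 : ℤ) ≤ ∏ s, y s ^ (-(3 / 2) : ℝ) := by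
  have hgm := Real.geom_mean_le_arith_mean_weighted Finset.univ (fun _ : S => (1 / 4 : ℝ))
    (fun s => y s ^ 2) (fun _ _ => by norm_num) (by simp [hS])
    (fun s _ => by positivity)
  have hpos : 0 < ∏ s, (y s ^ 2) ^ (1 / 4 : ℝ) :=
    Finset.prod_pos fun s _ => Real.rpow_pos_of_pos (pow_pos (hy s) 2) _
  have hle : ∏ s, (y s ^ 2) ^ (1 / 4 : ℝ) ≤ ∑ s, y s ^ 2 := by
    refine hgm.trans (Finset.sum_le_sum fun s _ => ?_)
    nlinarith [sq_nonneg (y s)]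
  calc (∑ s, y s ^ 2) ^ (-3 : ℤ) = ((∑ s, y s ^ 2) ^ 3)⁻¹ := by
        rw [zpow_neg]; rfl
    _ ≤ ((∏ s, (y s ^ 2) ^ (1 / 4 : ℝ)) ^ 3)⁻¹ := by gcongr
    _ = ∏ s, y s ^ (-(3 / 2) : ℝ) := by
        rw [← Finset.prod_pow, ← Finset.prod_inv_distrib]
        refine Finset.prod_congr rfl fun s _ => ?_
        rw [← Real.rpow_natCast, ← Real.rpow_natCast, ← Real.rpow_mul (hy s).le,
          ← Real.rpow_mul (hy s).le, ← Real.rpow_neg (hy s).le]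
        norm_num

/-- Convexity of `x ↦ x⁻³` passes from the sum over all groups to single groups. The right-hand
side is `⊤` if one of the numbers vanishes. -/
theorem ofReal_inv_pow_three_le {T S : Type*} [Fintype T] [Nonempty T] [Fintype S]
    (hS : Fintype.card S = 4) {c W : ℝ} (hc : 0 < c) (y : T → S → ℂ)
    (hW : c * ∑ t, ∑ s, ‖y t s‖ ^ 2 ≤ W) :
    ENNReal.ofReal (W⁻¹ ^ 3) ≤ ENNReal.ofReal (c⁻¹ ^ 3 * (Fintype.card T : ℝ)⁻¹ ^ 4) *
      ∑ t, ∏ s, ‖y t s‖ₑ ^ (-(3 / 2) : ℝ) := by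
  classical
  have hM : 0 < (Fintype.card T : ℝ) := by exact_mod_cast Fintype.card_pos
  have hcoef : 0 < c⁻¹ ^ 3 * (Fintype.card T : ℝ)⁻¹ ^ 4 := by positivity
  by_cases hy : ∀ t s, y t s ≠ 0
  · have hn : ∀ t s, 0 < ‖y t s‖ := fun t s => norm_pos_iff.2 (hy t s)
    have : Nonempty S := Fintype.card_pos_iff.1 (by omega)
    have hG : ∀ t, 0 < ∑ s, ‖y t s‖ ^ 2 := fun t =>
      Finset.sum_pos (fun s _ => pow_pos (hn t s) 2) Finset.univ_nonempty
    have hGsum : 0 < ∑ t, ∑ s, ‖y t s‖ ^ 2 :=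
      Finset.sum_pos (fun t _ => hG t) Finset.univ_nonempty
    have hconv := Real.zpow_arith_mean_le_arith_mean_zpow Finset.univ
      (fun _ : T => (Fintype.card T : ℝ)⁻¹) (fun t => ∑ s, ‖y t s‖ ^ 2)
      (fun _ _ => by positivity) (by simp [hM.ne']) (fun t _ => hG t) (-3)
    rw [← Finset.mul_sum, ← Finset.mul_sum] at hconv
    have hreal : W⁻¹ ^ 3 ≤ c⁻¹ ^ 3 * (Fintype.card T : ℝ)⁻¹ ^ 4 *
        ∑ t, ∏ s, ‖y t s‖ ^ (-(3 / 2) : ℝ) := by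
      have hW0 : 0 ≤ W⁻¹ := inv_nonneg.2 ((mul_pos hc hGsum).le.trans hW)
      calc W⁻¹ ^ 3 ≤ (c * ∑ t, ∑ s, ‖y t s‖ ^ 2)⁻¹ ^ 3 := by gcongr
        _ = c⁻¹ ^ 3 * (Fintype.card T : ℝ)⁻¹ ^ 3 *
            ((Fintype.card T : ℝ)⁻¹ * ∑ t, ∑ s, ‖y t s‖ ^ 2) ^ (-3 : ℤ) := by
          rw [zpow_neg, show (3 : ℤ) = ((3 : ℕ) : ℤ) from rfl, zpow_natCast]
          field_simp
        _ ≤ c⁻¹ ^ 3 * (Fintype.card T : ℝ)⁻¹ ^ 3 *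
            ((Fintype.card T : ℝ)⁻¹ * ∑ t, ∏ s, ‖y t s‖ ^ (-(3 / 2) : ℝ)) := by
          gcongr
          refine hconv.trans ?_
          gcongr with t _
          exact inv_sum_sq_pow_three_le_prod hS (hn t)
        _ = _ := by ring
    refine (ENNReal.ofReal_le_ofReal hreal).trans_eq ?_
    rw [ENNReal.ofReal_mul hcoef.le, ENNReal.ofReal_sum_of_nonneg fun t _ =>
      Finset.prod_nonneg fun s _ => by positivity]
    congr 1
    refine Finset.sum_congr rfl fun t _ => ?_
    rw [ENNReal.ofReal_prod_of_nonneg fun s _ => by positivity]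
    refine Finset.prod_congr rfl fun s _ => ?_
    rw [← ENNReal.ofReal_rpow_of_pos (hn t s), ofReal_norm]
  · push Not at hy
    obtain ⟨t, s, hts⟩ := hy
    have htop : ∏ s, ‖y t s‖ₑ ^ (-(3 / 2) : ℝ) = ⊤ := by
      rw [← Finset.mul_prod_erase _ _ (Finset.mem_univ s), hts, enorm_zero,
        ENNReal.zero_rpow_of_neg (by norm_num), ENNReal.top_mul]
      refine Finset.prod_ne_zero_iff.2 fun s' _ => ?_
      rw [Ne, ENNReal.rpow_eq_zero_iff]
      rintro (⟨-, h⟩ | ⟨h, -⟩)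
      · norm_num at h
      · exact enorm_ne_top h
    have hsum : ∑ t, ∏ s, ‖y t s‖ₑ ^ (-(3 / 2) : ℝ) = ⊤ :=
      top_le_iff.1 (htop ▸ Finset.single_le_sum
        (f := fun t => ∏ s, ‖y t s‖ₑ ^ (-(3 / 2) : ℝ)) (fun _ _ => zero_le) (Finset.mem_univ t))
    rw [hsum, ENNReal.mul_top (by simpa using hcoef)]
    exact le_top

theorem card_groupIndex_ge (N : ℕ) : ((N : ℝ) / 2) ^ 3 ≤ Fintype.card (GroupIndex N) := by
  have h : (N : ℝ) ≤ 2 * (((N + 1) / 2 : ℕ) : ℝ) := by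
    exact_mod_cast (by omega : N ≤ 2 * ((N + 1) / 2))
  have hcard : (Fintype.card (GroupIndex N) : ℝ) = (((N + 1) / 2 : ℕ) : ℝ) ^ 3 := by
    rw [Fintype.card_prod, Fintype.card_prod, Fintype.card_fin]
    push_cast
    ring
  rw [hcard]
  gcongr
  linarith

theorem exists_lintegral_prod_probeValue_le : ∃ K : ENNReal, K < ⊤ ∧
    ∀ (N : ℕ) (t : GroupIndex N),
      ∫⁻ X, ∏ s, ‖probeValue N X t s‖ₑ ^ (-(3 / 2) : ℝ) ∂coordinateLaw N ≤ K := by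
  obtain ⟨K, hK, h⟩ := exists_lintegral_enorm_modeLaw_le
  refine ⟨K ^ 4, ENNReal.pow_lt_top hK, fun N t => ?_⟩
  set f : halfLattice N → CVec → ENNReal := fun k x =>
    ‖x 1 - (((k : Wave) 1 : ℂ) / ((k : Wave) 0 : ℂ)) * x 0‖ₑ ^ (-(3 / 2) : ℝ) with hf
  have hfm : ∀ k, Measurable (f k) := fun k => by fun_prop
  have hind : iIndepFun (fun k (X : Coordinates N) => f k (X k)) (coordinateLaw N) :=
    iIndepFun_pi fun k => (hfm k).aemeasurable
  set g : ℤˣ × ℤˣ → halfLattice N := fun s => ⟨probeMode N t s, probeMode_mem_halfLattice N t s⟩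
    with hg
  have hginj : Function.Injective g := fun s s' hs => by
    have := probeMode_injective N (a₁ := (t, s)) (a₂ := (t, s')) (congrArg Subtype.val hs)
    exact (Prod.mk.injEq _ _ _ _ ▸ this).2
  have hprod := lintegral_prod_eq_prod_lintegral_of_indepFun Finset.univ _ (hind.precomp hginj)
    fun s => (hfm (g s)).comp (measurable_pi_apply _)
  refine hprod.trans_le ?_
  calc _ ≤ ∏ _s : ℤˣ × ℤˣ, K := by
        refine Finset.prod_le_prod' fun s _ => ?_
        have heval := (measurePreserving_eval (fun _ : halfLattice N => modeLaw)
          (g s)).lintegral_comp (hfm (g s))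
        exact heval.trans_le (h _)
    _ = K ^ 4 := by
        rw [Finset.prod_const, Finset.card_univ, Fintype.card_prod, Fintype.card_units_int]

/-- The inverse third moment of the energy is at most of order `N^{-(15 - 6a)}`. -/
theorem exists_lintegral_inv_energy_le : ∃ K : ENNReal, K < ⊤ ∧ ∀ N : ℕ, 1 ≤ N →
    ∀ a : ℕ, (a = 0 ∨ a = 1) →
      ∫⁻ X, ENNReal.ofReal ((energy N (rawField N a X))⁻¹ ^ 3) ∂coordinateLaw N ≤
        ENNReal.ofReal ((N : ℝ)⁻¹ ^ (15 - 6 * a)) * K := by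
  obtain ⟨K, hK, h⟩ := exists_lintegral_prod_probeValue_le
  refine ⟨ENNReal.ofReal (16 ^ 3 * 8 ^ 3) * K, ENNReal.mul_lt_top ENNReal.ofReal_lt_top hK,
    fun N hN a ha => ?_⟩
  have hN0 : 0 < (N : ℝ) := by exact_mod_cast hN
  set c : ℝ := (N : ℝ) ^ (2 - 2 * a) / 16 with hc
  have hc0 : 0 < c := by positivity
  set M : ℝ := (Fintype.card (GroupIndex N) : ℝ) with hM
  have hMge : ((N : ℝ) / 2) ^ 3 ≤ M := card_groupIndex_ge N
  have hM0 : 0 < M := lt_of_lt_of_le (by positivity) hMge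
  have : Nonempty (GroupIndex N) :=
    Fintype.card_pos_iff.1 (Nat.cast_pos.1 (hM ▸ hM0))
  have hmeas : ∀ t : GroupIndex N, Measurable fun X : Coordinates N =>
      ∏ s, ‖probeValue N X t s‖ₑ ^ (-(3 / 2) : ℝ) := by
    intro t
    unfold probeValue
    fun_prop
  calc _ ≤ ∫⁻ X, ENNReal.ofReal (c⁻¹ ^ 3 * M⁻¹ ^ 4) *
        ∑ t, ∏ s, ‖probeValue N X t s‖ₑ ^ (-(3 / 2) : ℝ) ∂coordinateLaw N :=
        lintegral_mono fun X => ofReal_inv_pow_three_le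
          (by rw [Fintype.card_prod, Fintype.card_units_int]) hc0 _ (sum_probeValue_le_energy ha X)
    _ = ENNReal.ofReal (c⁻¹ ^ 3 * M⁻¹ ^ 4) *
        ∑ t, ∫⁻ X, ∏ s, ‖probeValue N X t s‖ₑ ^ (-(3 / 2) : ℝ) ∂coordinateLaw N := by
        rw [lintegral_const_mul _ (Finset.measurable_sum _ fun t _ => hmeas t),
          lintegral_finsetSum _ fun t _ => hmeas t]
    _ ≤ ENNReal.ofReal (c⁻¹ ^ 3 * M⁻¹ ^ 4) * ∑ _t : GroupIndex N, K := by
        gcongr with t _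
        exact h N t
    _ = ENNReal.ofReal (c⁻¹ ^ 3 * M⁻¹ ^ 3) * K := by
        rw [Finset.sum_const, nsmul_eq_mul, Finset.card_univ, ← ENNReal.ofReal_natCast, ← hM,
          ← mul_assoc, ← ENNReal.ofReal_mul (by positivity)]
        congr 2
        field_simp
    _ ≤ ENNReal.ofReal ((N : ℝ)⁻¹ ^ (15 - 6 * a) * (16 ^ 3 * 8 ^ 3)) * K := by
        refine mul_le_mul_left (ENNReal.ofReal_le_ofReal ?_) _
        calc c⁻¹ ^ 3 * M⁻¹ ^ 3 ≤ c⁻¹ ^ 3 * (((N : ℝ) / 2) ^ 3)⁻¹ ^ 3 := by gcongr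
          _ = (N : ℝ)⁻¹ ^ (15 - 6 * a) * (16 ^ 3 * 8 ^ 3) := by
            rw [hc]
            rcases ha with rfl | rfl
            · norm_num; field_simp; norm_num
            · norm_num; field_simp; norm_num
    _ = _ := by rw [ENNReal.ofReal_mul (by positivity), mul_assoc]

/-! ### Moments of the transfer terms -/

theorem measurable_modeSq (N : ℕ) (k : Wave) : Measurable fun X => modeSq N X k := by
  unfold modeSq
  split_ifs
  · exact measurable_vecSq.comp (measurable_pi_apply _)
  · exact measurable_vecSq.comp (measurable_pi_apply _)
  · exact measurable_const

theorem lintegral_modeSq_pow_three_le (N : ℕ) (k : Wave) :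
    ∫⁻ X, ENNReal.ofReal (modeSq N X k ^ 3) ∂coordinateLaw N ≤
      ∫⁻ x, ENNReal.ofReal (vecSq x ^ 3) ∂modeLaw := by
  have heval : ∀ l : halfLattice N,
      ∫⁻ X, ENNReal.ofReal (vecSq (X l) ^ 3) ∂coordinateLaw N =
        ∫⁻ x, ENNReal.ofReal (vecSq x ^ 3) ∂modeLaw := fun l =>
    (measurePreserving_eval (fun _ : halfLattice N => modeLaw) l).lintegral_comp
      (measurable_vecSq.pow_const 3).ennreal_ofReal
  unfold modeSq
  split_ifs
  · exact (heval _).le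
  · exact (heval _).le
  · simp

theorem lintegral_modeSq_mul_le (N : ℕ) (k p q : Wave) :
    ∫⁻ X, ENNReal.ofReal (modeSq N X k * modeSq N X p * modeSq N X q) ∂coordinateLaw N ≤
      3 * ∫⁻ x, ENNReal.ofReal (vecSq x ^ 3) ∂modeLaw := by
  have hm : ∀ l, Measurable fun X => ENNReal.ofReal (modeSq N X l ^ 3) := fun l =>
    ((measurable_modeSq N l).pow_const 3).ennreal_ofReal
  calc _ ≤ ∫⁻ X, (ENNReal.ofReal (modeSq N X k ^ 3) + ENNReal.ofReal (modeSq N X p ^ 3) +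
        ENNReal.ofReal (modeSq N X q ^ 3)) ∂coordinateLaw N := by
        refine lintegral_mono fun X => ?_
        have hx := modeSq_nonneg N X k
        have hy := modeSq_nonneg N X p
        have hz := modeSq_nonneg N X q
        rw [← ENNReal.ofReal_add (by positivity) (by positivity),
          ← ENNReal.ofReal_add (by positivity) (by positivity)]
        refine ENNReal.ofReal_le_ofReal ?_
        generalize modeSq N X k = x at *
        generalize modeSq N X p = y at *
        generalize modeSq N X q = z at *
        have h3 : 0 ≤ (x + y + z) * ((x - y) ^ 2 + (y - z) ^ 2 + (z - x) ^ 2) := by positivity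
        nlinarith [pow_nonneg hx 3, pow_nonneg hy 3, pow_nonneg hz 3]
    _ ≤ _ := by
        rw [lintegral_add_right _ (hm q), lintegral_add_right _ (hm p)]
        have hk := lintegral_modeSq_pow_three_le N k
        have hp := lintegral_modeSq_pow_three_le N p
        have hq := lintegral_modeSq_pow_three_le N q
        refine (add_le_add (add_le_add hk hp) hq).trans_eq ?_
        ring

/-- A bound for the squared Frobenius norm of the stretching matrix before normalization: the
weighted sum of the products `|X_k|² |X_p|² |X_{k-p}|²`, times the maximal orbit size `48`. -/
noncomputable def transferSum (N a : ℕ) (X : Coordinates N) : ℝ :=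
  48 * ∑ k ∈ lattice N, ∑ p ∈ lattice N,
    pairWeight N a k p * (modeSq N X k * modeSq N X p * modeSq N X (k - p))

theorem transferSum_nonneg (N a : ℕ) (X : Coordinates N) : 0 ≤ transferSum N a X :=
  mul_nonneg (by norm_num) (Finset.sum_nonneg fun k _ => Finset.sum_nonneg fun p _ =>
    mul_nonneg (pairWeight_nonneg N a k p) (mul_nonneg
      (mul_nonneg (modeSq_nonneg N X k) (modeSq_nonneg N X p)) (modeSq_nonneg N X (k - p))))

theorem measurable_transferSum (N a : ℕ) : Measurable (transferSum N a) := by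
  unfold transferSum
  refine Measurable.const_mul (Finset.measurable_sum _ fun k _ => Finset.measurable_sum _
    fun p _ => ?_) _
  exact (((measurable_modeSq N k).mul (measurable_modeSq N p)).mul
    (measurable_modeSq N (k - p))).const_mul _

/-- The mean of the transfer sum is at most of order `N^{12 - 6a}`. -/
theorem exists_lintegral_transferSum_le : ∃ K : ENNReal, K < ⊤ ∧ ∀ N : ℕ, 1 ≤ N →
    ∀ a : ℕ, (a = 0 ∨ a = 1) →
      ∫⁻ X, ENNReal.ofReal (transferSum N a X) ∂coordinateLaw N ≤
        ENNReal.ofReal ((N : ℝ) ^ (12 - 6 * a)) * K := by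
  set m := ∫⁻ x, ENNReal.ofReal (vecSq x ^ 3) ∂modeLaw with hm
  refine ⟨ENNReal.ofReal (48 * 19683) * (3 * m), ENNReal.mul_lt_top ENNReal.ofReal_lt_top
    (ENNReal.mul_lt_top (by simp) lintegral_vecSq_pow_three_lt_top), fun N hN a ha => ?_⟩
  set g : Wave → Wave → Coordinates N → ℝ := fun k p X =>
    modeSq N X k * modeSq N X p * modeSq N X (k - p) with hg
  have hgm : ∀ k p, Measurable fun X => ENNReal.ofReal (g k p X) := fun k p =>
    (((measurable_modeSq N k).mul (measurable_modeSq N p)).mul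
      (measurable_modeSq N (k - p))).ennreal_ofReal
  have hg0 : ∀ k p X, 0 ≤ g k p X := fun k p X => mul_nonneg
    (mul_nonneg (modeSq_nonneg N X k) (modeSq_nonneg N X p)) (modeSq_nonneg N X (k - p))
  have hsplit : ∀ X, ENNReal.ofReal (transferSum N a X) = ENNReal.ofReal 48 *
      ∑ x ∈ lattice N ×ˢ lattice N,
        ENNReal.ofReal (pairWeight N a x.1 x.2) * ENNReal.ofReal (g x.1 x.2 X) := by
    intro X
    rw [transferSum, ENNReal.ofReal_mul (by norm_num), ← Finset.sum_product',
      ENNReal.ofReal_sum_of_nonneg fun x _ =>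
        mul_nonneg (pairWeight_nonneg N a x.1 x.2) (hg0 x.1 x.2 X)]
    congr 1
    exact Finset.sum_congr rfl fun x _ => ENNReal.ofReal_mul (pairWeight_nonneg N a x.1 x.2)
  simp only [hsplit]
  rw [lintegral_const_mul _ (Finset.measurable_sum _ fun x _ => (hgm x.1 x.2).const_mul _),
    lintegral_finsetSum _ fun x _ => (hgm x.1 x.2).const_mul _]
  calc _ ≤ ENNReal.ofReal 48 * ∑ x ∈ lattice N ×ˢ lattice N,
        ENNReal.ofReal (pairWeight N a x.1 x.2) * (3 * m) := by
        gcongr with x _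
        rw [lintegral_const_mul _ (hgm x.1 x.2)]
        gcongr
        exact lintegral_modeSq_mul_le N x.1 x.2 (x.1 - x.2)
    _ = ENNReal.ofReal (48 * ∑ k ∈ lattice N, ∑ p ∈ lattice N, pairWeight N a k p) *
        (3 * m) := by
        rw [← Finset.sum_mul, ← ENNReal.ofReal_sum_of_nonneg fun x _ =>
          pairWeight_nonneg N a x.1 x.2, ← mul_assoc, ← ENNReal.ofReal_mul (by norm_num),
          Finset.sum_product]
    _ ≤ ENNReal.ofReal ((N : ℝ) ^ (12 - 6 * a) * (48 * 19683)) * (3 * m) := by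
        refine mul_le_mul_left (ENNReal.ofReal_le_ofReal ?_) _
        have := sum_pairWeight_le hN ha
        linarith
    _ = _ := by rw [ENNReal.ofReal_mul (by positivity), mul_assoc]

/-! ### Measurability of the spectral radius -/

theorem measurable_rawField (N a : ℕ) (k : Wave) (i : Fin 3) :
    Measurable fun X => rawField N a X k i := by
  unfold rawField
  split_ifs
  · unfold leray dot
    fun_prop
  · unfold conjVec leray dot
    refine Complex.continuous_conj.measurable.comp ?_
    fun_prop
  · exact measurable_const

theorem measurable_energy_rawField (N a : ℕ) :
    Measurable fun X => energy N (rawField N a X) := by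
  have h := measurable_rawField N a
  unfold energy
  fun_prop

theorem measurable_ensembleField (N a : ℕ) (k : Wave) (i : Fin 3) :
    Measurable fun X => ensembleField N a X k i := by
  unfold ensembleField
  exact (measurable_rawField N a k i).div
    (Complex.measurable_ofReal.comp (measurable_energy_rawField N a).sqrt)

theorem measurable_stretchingRadius (N a : ℕ) :
    Measurable fun X => stretchingRadius N (ensembleField N a X) := by
  have hu := measurable_ensembleField N a
  have hS : ∀ α β, Measurable fun X => transferMatrix N (ensembleField N a X) α β := by
    intro α β
    simp only [transferMatrix, Matrix.of_apply]
    refine Measurable.const_mul (Finset.measurable_sum _ fun k _ => Finset.measurable_sum _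
      fun p _ => Measurable.const_mul (Complex.measurable_re.comp ?_) _) _
    unfold nonlinearTerm leray
    simp only [dot, conjVec]
    refine Finset.measurable_sum _ fun i _ =>
      (Complex.continuous_conj.measurable.comp (hu k i)).mul ?_
    fun_prop
  refine (measurable_spectralRadius fun α β => ?_).ennreal_toReal
  simp only [Matrix.map_apply, stretchingMatrix, Matrix.of_apply]
  exact Complex.measurable_ofReal.comp (((hS α β).add (hS β α)).div_const 2)

/-! ### The expected spectral radius -/

theorem stretchingRadius_nonneg (N : ℕ) (u : Wave → CVec) : 0 ≤ stretchingRadius N u :=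
  ENNReal.toReal_nonneg

/-- The numerator and the normalization are decoupled by the inequality between arithmetic and
geometric mean, with a free weight `c`. -/
theorem stretchingRadius_le_add (N a : ℕ) (X : Coordinates N) {c : ℝ} (hc : 0 < c) :
    stretchingRadius N (ensembleField N a X) ≤
      c * transferSum N a X + c⁻¹ * (energy N (rawField N a X))⁻¹ ^ 3 := by
  have hA := transferSum_nonneg N a X
  have hB : 0 ≤ (energy N (rawField N a X))⁻¹ ^ 3 :=
    pow_nonneg (inv_nonneg.2 (energy_nonneg _ _)) 3
  have h : stretchingRadius N (ensembleField N a X) ^ 2 ≤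
      transferSum N a X * (energy N (rawField N a X))⁻¹ ^ 3 :=
    stretchingRadius_ensembleField_sq_le N a X
  have hA' : 0 ≤ c * transferSum N a X := by positivity
  have hB' : 0 ≤ c⁻¹ * (energy N (rawField N a X))⁻¹ ^ 3 := by positivity
  have hprod : (c * transferSum N a X) * (c⁻¹ * (energy N (rawField N a X))⁻¹ ^ 3) =
      transferSum N a X * (energy N (rawField N a X))⁻¹ ^ 3 := by
    rw [mul_mul_mul_comm, mul_inv_cancel₀ hc.ne', one_mul]
  refine le_of_sq_le_sq ?_ (add_nonneg hA' hB')
  nlinarith [mul_nonneg hA' hB', sq_nonneg (c * transferSum N a X),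
    sq_nonneg (c⁻¹ * (energy N (rawField N a X))⁻¹ ^ 3)]

theorem exists_lintegral_stretchingRadius_le : ∃ C : ℝ, 0 < C ∧ ∀ N : ℕ, 1 ≤ N →
    ∀ a : ℕ, (a = 0 ∨ a = 1) →
      ∫⁻ X, ENNReal.ofReal (stretchingRadius N (ensembleField N a X)) ∂coordinateLaw N ≤
        ENNReal.ofReal (C * (N : ℝ) ^ (-(3 / 2) : ℝ)) := by
  obtain ⟨K, hK, hA⟩ := exists_lintegral_transferSum_le
  obtain ⟨L, hL, hB⟩ := exists_lintegral_inv_energy_le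
  refine ⟨K.toReal + L.toReal + 1, by positivity, fun N hN a ha => ?_⟩
  have hN0 : 0 < (N : ℝ) := by exact_mod_cast hN
  set s : ℝ := (N : ℝ) ^ (-(3 / 2) : ℝ) with hs
  have hs0 : 0 < s := Real.rpow_pos_of_pos hN0 _
  have hs2 : s ^ 2 = ((N : ℝ)⁻¹) ^ 3 := by
    rw [hs, ← Real.rpow_natCast, ← Real.rpow_mul hN0.le, inv_pow, ← Real.rpow_natCast _ 3,
      ← Real.rpow_neg hN0.le]
    norm_num
  -- With this weight both terms of the decoupled bound are of order `N^{-3/2}`.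
  set c : ℝ := s * ((N : ℝ) ^ (12 - 6 * a))⁻¹ with hc
  have hc0 : 0 < c := by positivity
  have h1 : c * (N : ℝ) ^ (12 - 6 * a) = s := by
    rw [hc, inv_mul_cancel_right₀ (by positivity)]
  have h2 : c⁻¹ * (N : ℝ)⁻¹ ^ (15 - 6 * a) = s := by
    have he : 15 - 6 * a = (12 - 6 * a) + 3 := by omega
    rw [he, pow_add, ← hs2, hc, mul_inv, inv_inv, inv_pow]
    field_simp
  have hAm : Measurable fun X => ENNReal.ofReal (transferSum N a X) :=
    (measurable_transferSum N a).ennreal_ofReal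
  have hBm : Measurable fun X : Coordinates N =>
      ENNReal.ofReal ((energy N (rawField N a X))⁻¹ ^ 3) :=
    ((measurable_energy_rawField N a).inv.pow_const 3).ennreal_ofReal
  calc _ ≤ ∫⁻ X, (ENNReal.ofReal c * ENNReal.ofReal (transferSum N a X) +
        ENNReal.ofReal c⁻¹ * ENNReal.ofReal ((energy N (rawField N a X))⁻¹ ^ 3))
        ∂coordinateLaw N := by
        refine lintegral_mono fun X => ?_
        rw [← ENNReal.ofReal_mul hc0.le, ← ENNReal.ofReal_mul (inv_pos.2 hc0).le]
        exact (ENNReal.ofReal_le_ofReal (stretchingRadius_le_add N a X hc0)).trans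
          ENNReal.ofReal_add_le
    _ = ENNReal.ofReal c * ∫⁻ X, ENNReal.ofReal (transferSum N a X) ∂coordinateLaw N +
        ENNReal.ofReal c⁻¹ *
          ∫⁻ X, ENNReal.ofReal ((energy N (rawField N a X))⁻¹ ^ 3) ∂coordinateLaw N := by
        rw [lintegral_add_left (hAm.const_mul _), lintegral_const_mul _ hAm,
          lintegral_const_mul _ hBm]
    _ ≤ ENNReal.ofReal c * (ENNReal.ofReal ((N : ℝ) ^ (12 - 6 * a)) * K) +
        ENNReal.ofReal c⁻¹ * (ENNReal.ofReal ((N : ℝ)⁻¹ ^ (15 - 6 * a)) * L) := by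
        gcongr
        · exact hA N hN a ha
        · exact hB N hN a ha
    _ = ENNReal.ofReal s * (K + L) := by
        rw [← mul_assoc, ← mul_assoc, ← ENNReal.ofReal_mul hc0.le,
          ← ENNReal.ofReal_mul (inv_pos.2 hc0).le, h1, h2, mul_add]
    _ ≤ ENNReal.ofReal s * ENNReal.ofReal (K.toReal + L.toReal + 1) := by
        gcongr
        rw [← ENNReal.ofReal_toReal hK.ne, ← ENNReal.ofReal_toReal hL.ne,
          ← ENNReal.ofReal_add ENNReal.toReal_nonneg ENNReal.toReal_nonneg]
        simp only [ENNReal.toReal_ofReal ENNReal.toReal_nonneg]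
        exact ENNReal.ofReal_le_ofReal (by linarith)
    _ = _ := by rw [← ENNReal.ofReal_mul hs0.le, mul_comm]

end CubicGalerkin

/-- The case `a = 0` is the ensemble of standard complex Gaussian coordinates, projected and
normalized; the case `a = 1` is the same ensemble with the prior `E |v_k|² ∝ |k|⁻²`. -/
theorem mainTheorem2 :
    ∃ C : ℝ, 0 < C ∧ ∀ N : ℕ, 1 ≤ N → ∀ a : ℕ, (a = 0 ∨ a = 1) →
      Integrable (fun X => CubicGalerkin.stretchingRadius N (CubicGalerkin.ensembleField N a X))
        (CubicGalerkin.coordinateLaw N) ∧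
      ∫ X, CubicGalerkin.stretchingRadius N (CubicGalerkin.ensembleField N a X)
          ∂(CubicGalerkin.coordinateLaw N) ≤ C * (N : ℝ) ^ (-(3 / 2) : ℝ) ∧
      ∫ X, CubicGalerkin.criticalThreshold N (CubicGalerkin.ensembleField N a X)
          ∂(CubicGalerkin.coordinateLaw N) =
        (∫ X, CubicGalerkin.stretchingRadius N (CubicGalerkin.ensembleField N a X)
          ∂(CubicGalerkin.coordinateLaw N)) / (N : ℝ) ^ 2 ∧
      ∫ X, CubicGalerkin.criticalThreshold N (CubicGalerkin.ensembleField N a X)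
          ∂(CubicGalerkin.coordinateLaw N) ≤ C * (N : ℝ) ^ (-(7 / 2) : ℝ) := by
  obtain ⟨C, hC, h⟩ := CubicGalerkin.exists_lintegral_stretchingRadius_le
  refine ⟨C, hC, fun N hN a ha => ?_⟩
  have hN0 : 0 < (N : ℝ) := by exact_mod_cast hN
  have hle := h N hN a ha
  have hmeas := CubicGalerkin.measurable_stretchingRadius N a
  have hnonneg : ∀ X, 0 ≤ CubicGalerkin.stretchingRadius N (CubicGalerkin.ensembleField N a X) :=
    fun X => CubicGalerkin.stretchingRadius_nonneg _ _
  have hint : Integrable (fun X => CubicGalerkin.stretchingRadius N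
      (CubicGalerkin.ensembleField N a X)) (CubicGalerkin.coordinateLaw N) := by
    refine ⟨hmeas.aestronglyMeasurable, ?_⟩
    rw [hasFiniteIntegral_iff_ofReal (Filter.Eventually.of_forall hnonneg)]
    exact hle.trans_lt ENNReal.ofReal_lt_top
  have hbound : ∫ X, CubicGalerkin.stretchingRadius N (CubicGalerkin.ensembleField N a X)
      ∂(CubicGalerkin.coordinateLaw N) ≤ C * (N : ℝ) ^ (-(3 / 2) : ℝ) := by
    rw [integral_eq_lintegral_of_nonneg_ae (Filter.Eventually.of_forall hnonneg)
      hmeas.aestronglyMeasurable]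
    exact ENNReal.toReal_le_of_le_ofReal (by positivity) hle
  have hthr : ∫ X, CubicGalerkin.criticalThreshold N (CubicGalerkin.ensembleField N a X)
      ∂(CubicGalerkin.coordinateLaw N) =
      (∫ X, CubicGalerkin.stretchingRadius N (CubicGalerkin.ensembleField N a X)
        ∂(CubicGalerkin.coordinateLaw N)) / (N : ℝ) ^ 2 := integral_div _ _
  refine ⟨hint, hbound, hthr, ?_⟩
  rw [hthr, div_le_iff₀ (by positivity), mul_assoc, ← Real.rpow_natCast (N : ℝ) 2,
    ← Real.rpow_add hN0]
  norm_num
  norm_num at hbound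
  exact hbound
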